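/- A permutation $x\in S_n$ represents a deck of cards labelled $1,\dots,n$, with $x(c)$ the position of card $c$ (counted from the left). For cards $a,b\in\{1,\dots,n\}$ let $M_{a,b}:S_n\to S_n$ be the operation that removes card $a$ from the deck and re-inserts it immediately to the right of card $b$ if $a\ne b$, and at the leftmost position if $a=b$. The random-to-random insertion shuffle is the Markov chain on $S_n$ which at each step moves from the current state $x$ to $M_{a,b}(x)$, with $(a,b)$ uniform on $\{1,\dots,n\}^2$; let $P$ be its transition matrix, and write $\|\mu-\nu\|=\frac12\sum_{y\in S_n}|\mu(y)-\nu(y)|$ for the total variation distance. Let $a=0.6526$. There is an $N$ such that for all $n\ge N$, all $x,x'\in S_n$ with $x'=(i,j)\,x$ for some transposition $(i,j)$, and all integers $t>n\log n$, \[ \|P^t(x,\cdot)-P^t(x',\cdot)\|\le e^{-at/n}. \] -/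

import Mathlib

/-!
Decks of `n` cards.  Cards and positions are both labelled by `Fin n`, positions being counted from
the left, and a permutation `x : Equiv.Perm (Fin n)` is the deck in which card `c` is at
position `x c`.
-/

namespace RandomToRandom

/-- Take out the item at position `p` and put it back so that its final position is `q`; the other
items keep their relative order.  The value at a position is the new position of the item that was
there: `p` goes to `q` and `p.succAbove k` goes to `q.succAbove k`. -/
def moveTo : {n : ℕ} → Fin n → Fin n → Equiv.Perm (Fin n)
  | 0, p, _ => p.elim0
  | _ + 1, p, q => (finSuccEquiv' p).trans (finSuccEquiv' q).symm

/-- The final position of card `a` when it is taken out of the deck `x` and put back immediately to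
the right of card `b` if `a ≠ b`, and at the leftmost position if `a = b`. -/
def newPos {n : ℕ} (a b : Fin n) (x : Equiv.Perm (Fin n)) : Fin n :=
  if a = b then ⟨0, a.pos⟩
  else if h : x b < x a then ⟨(x b : ℕ) + 1, lt_of_le_of_lt (Nat.succ_le_of_lt h) (x a).isLt⟩
  else x b

/-- The shuffle `M_{a,b}`: remove card `a` and re-insert it immediately to the right of card `b`
if `a ≠ b`, and at the leftmost position if `a = b`. -/
def shuffle {n : ℕ} (a b : Fin n) (x : Equiv.Perm (Fin n)) : Equiv.Perm (Fin n) :=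
  x.trans (moveTo (x a) (newPos a b x))

/-- The transition matrix of the random-to-random insertion shuffle on `n` cards: from `x`, move to
`shuffle a b x` with `(a, b)` uniform among the `n ^ 2` pairs of cards. -/
noncomputable def transition (n : ℕ) :
    Matrix (Equiv.Perm (Fin n)) (Equiv.Perm (Fin n)) ℝ :=
  Matrix.of fun x y =>
    ((Finset.univ.filter fun ab : Fin n × Fin n => shuffle ab.1 ab.2 x = y).card : ℝ) / (n : ℝ) ^ 2

/-- Two permutations are adjacent if one is a transposition times the other. -/
def Adjacent {n : ℕ} (x x' : Equiv.Perm (Fin n)) : Prop :=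
  ∃ i j : Fin n, i ≠ j ∧ x' = Equiv.swap i j * x

/-- Total variation distance between two probability vectors on a finite set. -/
noncomputable def tvDist {V : Type*} [Fintype V] (μ ν : V → ℝ) : ℝ :=
  1 / 2 * ∑ v, |μ v - ν v|

end RandomToRandom

namespace RandomToRandom

open Finset

/-! The swap is rewritten as a relabelling of cards, and the argument runs backwards in time on test
functions. If `g` sees only the relative order of a card set `A`, then `g` after the move `M_{a,b}`
sees only the order of `ancestors a b A`: a moved card `a` in `A` is located by `b`, or dropped if
it goes leftmost. Starting from all cards, this is a random set process; once it avoids both `i` and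
`j`, interchanging these cards no longer changes the expectation. Total variation is thus bounded by
the chance that the set still meets `{i, j}`.

That chance is controlled by `potential`, which contracts by `1 - 0.7 / n` per step
(`sum_potential_le`). Its term `#A / n` matters because a lone `i` can regain `j` at a rate
proportional to `#A`, while `A` itself shrinks whenever `a` and `b` both lie in it. The gap between
0.7 and 0.6526 absorbs the prefactor 2.65. -/

/-! ### Relative order of cards after one move -/

lemma moveTo_self {n : ℕ} (p q : Fin n) : moveTo p q p = q := by
  cases n with
  | zero => exact p.elim0
  | succ n => simp [moveTo]

lemma moveTo_lt_moveTo {n : ℕ} {p q u v : Fin n} (hu : u ≠ p) (hv : v ≠ p) :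
    moveTo p q u < moveTo p q v ↔ u < v := by
  cases n with
  | zero => exact p.elim0
  | succ n =>
    obtain ⟨k, rfl⟩ := Fin.exists_succAbove_eq hu
    obtain ⟨l, rfl⟩ := Fin.exists_succAbove_eq hv
    simp [moveTo]

/-- The tie `v = q` is the item displaced by the insertion: it is pushed right exactly when the
moved item came from its right. -/
lemma lt_moveTo {n : ℕ} {p q v : Fin n} (hv : v ≠ p) :
    q < moveTo p q v ↔ (q : ℕ) < v ∨ (q : ℕ) = v ∧ v < p := by
  cases n with
  | zero => exact p.elim0
  | succ n =>
    obtain ⟨l, rfl⟩ := Fin.exists_succAbove_eq hv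
    simp only [moveTo, Equiv.trans_apply, finSuccEquiv'_succAbove, finSuccEquiv'_symm_some,
      Fin.lt_def]
    unfold Fin.succAbove
    split_ifs with h1 h2 h2 <;> simp only [Fin.lt_def, Fin.val_castSucc, Fin.val_succ] at * <;> omega

lemma shuffle_lt_shuffle {n : ℕ} {a b c d : Fin n} (x : Equiv.Perm (Fin n))
    (hc : c ≠ a) (hd : d ≠ a) : shuffle a b x c < shuffle a b x d ↔ x c < x d :=
  moveTo_lt_moveTo (x.injective.ne hc) (x.injective.ne hd)

lemma shuffle_moved_lt {n : ℕ} {a b c : Fin n} (x : Equiv.Perm (Fin n)) (hc : c ≠ a) :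
    shuffle a b x a < shuffle a b x c ↔ a = b ∨ x b < x c := by
  have hca : x c ≠ x a := x.injective.ne hc
  simp only [shuffle, Equiv.trans_apply, moveTo_self]
  rw [lt_moveTo hca]
  have hne : (x c : ℕ) ≠ x a := fun h => hca (Fin.ext h)
  unfold newPos
  split_ifs with h1 h2
  · simp only [h1, Fin.lt_def, true_or, iff_true]
    rw [h1] at hne
    omega
  · simp only [Fin.lt_def, h1, false_or] at *
    omega
  · have hba : (x b : ℕ) ≠ x a := fun h => h1 (x.injective (Fin.ext h)).symm
    simp only [Fin.lt_def, h1, false_or] at *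
    omega

lemma shuffle_lt_moved {n : ℕ} {a b c : Fin n} (x : Equiv.Perm (Fin n)) (hc : c ≠ a) :
    shuffle a b x c < shuffle a b x a ↔ ¬ (a = b ∨ x b < x c) := by
  rw [← shuffle_moved_lt x hc, not_lt]
  exact ⟨le_of_lt, fun h => lt_of_le_of_ne h ((shuffle a b x).injective.ne hc)⟩

/-- Relabelling the cards by `τ` commutes with the shuffle. -/
lemma shuffle_relabel {n : ℕ} (τ : Equiv.Perm (Fin n)) (a b : Fin n) (x : Equiv.Perm (Fin n)) :
    shuffle a b (x * τ) = shuffle (τ a) (τ b) x * τ := by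
  have h : newPos a b (x * τ) = newPos (τ a) (τ b) x := by
    by_cases h1 : a = b
    · simp [newPos, h1]
    · by_cases h2 : x (τ b) < x (τ a) <;> simp [newPos, h1, h2]
  ext c
  simp [shuffle, h]

/-! ### Ancestor sets and order-determined functions -/

/-- The cards whose relative order before the move `M_{a,b}` determines the relative order of the
cards of `A` after it. -/
def ancestors {n : ℕ} (a b : Fin n) (A : Finset (Fin n)) : Finset (Fin n) :=
  if a ∈ A then (if a = b then A.erase a else insert b (A.erase a)) else A

lemma mem_ancestors {n : ℕ} {a b c : Fin n} {A : Finset (Fin n)} (ha : a ∈ A) :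
    c ∈ ancestors a b A ↔ c ≠ a ∧ c ∈ A ∨ a ≠ b ∧ c = b := by
  unfold ancestors
  split_ifs with hab
  · simp [hab]
  · simp [hab, or_comm]

/-- The two decks put the cards of `A` in the same relative order. -/
def SameOrder {n : ℕ} (A : Finset (Fin n)) (x y : Equiv.Perm (Fin n)) : Prop :=
  ∀ c ∈ A, ∀ d ∈ A, x c < x d ↔ y c < y d

/-- The function `g` of a deck depends only on the relative order of the cards of `A`. -/
def OrderDetermined {n : ℕ} (A : Finset (Fin n)) (g : Equiv.Perm (Fin n) → ℝ) : Prop :=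
  ∀ x y, SameOrder A x y → g x = g y

lemma SameOrder.shuffle {n : ℕ} {a b : Fin n} {A : Finset (Fin n)} {x y : Equiv.Perm (Fin n)}
    (h : SameOrder (ancestors a b A) x y) : SameOrder A (shuffle a b x) (shuffle a b y) := by
  have keep : ∀ c ∈ A, c ≠ a → c ∈ ancestors a b A := by
    intro c hc hca
    unfold ancestors
    split_ifs <;> simp [hc, hca]
  have target : a ∈ A → a ≠ b → b ∈ ancestors a b A := by
    intro ha hab
    simp [ancestors, ha, hab]
  intro c hc d hd
  by_cases hca : c = a
  · by_cases hda : d = a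
    · simp [hca, hda]
    · subst hca
      rw [shuffle_moved_lt x hda, shuffle_moved_lt y hda]
      by_cases hab : c = b
      · simp [hab]
      · simp only [hab, false_or]
        exact h _ (target hc hab) _ (keep d hd hda)
  · by_cases hda : d = a
    · subst hda
      rw [shuffle_lt_moved x hca, shuffle_lt_moved y hca]
      by_cases hab : d = b
      · simp [hab]
      · simp only [hab, false_or]
        exact not_congr (h _ (target hd hab) _ (keep c hc hca))
    · rw [shuffle_lt_shuffle x hca hda, shuffle_lt_shuffle y hca hda]
      exact h _ (keep c hc hca) _ (keep d hd hda)

lemma OrderDetermined.comp_shuffle {n : ℕ} {A : Finset (Fin n)} {g : Equiv.Perm (Fin n) → ℝ}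
    (hg : OrderDetermined A g) (a b : Fin n) :
    OrderDetermined (ancestors a b A) fun x => g (shuffle a b x) :=
  fun _ _ h => hg _ _ h.shuffle

lemma orderDetermined_univ {n : ℕ} (g : Equiv.Perm (Fin n) → ℝ) :
    OrderDetermined Finset.univ g := by
  intro x y h
  -- An increasing bijection of `Fin n` is the identity.
  have hmono : StrictMono (fun p => y (x.symm p)) := by
    intro p q hpq
    exact (h _ (mem_univ _) _ (mem_univ _)).1 (by simpa using hpq)
  have hid : (fun p => y (x.symm p)) = id :=
    hmono.range_inj strictMono_id |>.1 (by
      rw [Set.range_id]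
      exact (x.symm.trans y).surjective.range_eq)
  congr 1
  ext c
  have := congrFun hid (x c)
  simp only [Equiv.symm_apply_apply, id] at this
  rw [this]

lemma SameOrder.relabel_swap {n : ℕ} {A : Finset (Fin n)} {i j : Fin n} (hi : i ∉ A) (hj : j ∉ A)
    (x : Equiv.Perm (Fin n)) : SameOrder A x (x * Equiv.swap i j) := by
  have fixed : ∀ c ∈ A, Equiv.swap i j c = c := fun c hc =>
    Equiv.swap_apply_of_ne_of_ne (fun h => hi (h ▸ hc)) (fun h => hj (h ▸ hc))
  intro c hc d hd
  simp [fixed c hc, fixed d hd]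

/-! ### Expectations under the chain -/

lemma transition_mulVec {n : ℕ} (g : Equiv.Perm (Fin n) → ℝ) (x : Equiv.Perm (Fin n)) :
    (transition n).mulVec g x = (∑ a, ∑ b, g (shuffle a b x)) / (n : ℝ) ^ 2 := by
  have h : ∀ y, transition n x y * g y =
      (∑ ab : Fin n × Fin n, if shuffle ab.1 ab.2 x = y then g y else 0) / (n : ℝ) ^ 2 := by
    intro y
    rw [← Finset.sum_filter, Finset.sum_const, nsmul_eq_mul]
    simp only [transition, Matrix.of_apply]
    ring
  simp only [Matrix.mulVec, dotProduct, h]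
  rw [← Finset.sum_div, Finset.sum_comm]
  simp [Fintype.sum_prod_type]

/-- The expectation of `g` after `s` steps of the shuffle started from `x`. -/
noncomputable def expect {n : ℕ} (s : ℕ) (g : Equiv.Perm (Fin n) → ℝ) (x : Equiv.Perm (Fin n)) : ℝ :=
  (transition n ^ s).mulVec g x

lemma expect_zero {n : ℕ} (g : Equiv.Perm (Fin n) → ℝ) (x : Equiv.Perm (Fin n)) :
    expect 0 g x = g x := by
  simp [expect]

lemma expect_succ' {n : ℕ} (s : ℕ) (g : Equiv.Perm (Fin n) → ℝ) (x : Equiv.Perm (Fin n)) :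
    expect (s + 1) g x = (∑ a, ∑ b, expect s g (shuffle a b x)) / (n : ℝ) ^ 2 := by
  rw [expect, pow_succ', ← Matrix.mulVec_mulVec, transition_mulVec]
  rfl

/-- Conditioning on the last move, rather than the first, folds it into the test function, which is
what turns `A` into its ancestors. -/
lemma expect_succ {n : ℕ} (s : ℕ) (g : Equiv.Perm (Fin n) → ℝ) (x : Equiv.Perm (Fin n)) :
    expect (s + 1) g x =
      (∑ a, ∑ b, expect s (fun y => g (shuffle a b y)) x) / (n : ℝ) ^ 2 := by
  rw [expect, pow_succ, ← Matrix.mulVec_mulVec]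
  have h : (transition n).mulVec g =
      fun y => (∑ a, ∑ b, g (shuffle a b y)) / (n : ℝ) ^ 2 := funext (transition_mulVec g)
  rw [h]
  simp only [expect, Matrix.mulVec, dotProduct]
  simp only [mul_div_assoc', Finset.mul_sum, ← Finset.sum_div]
  congr 1
  rw [Finset.sum_comm]
  exact Finset.sum_congr rfl fun a _ => Finset.sum_comm

lemma expect_relabel {n : ℕ} (τ : Equiv.Perm (Fin n)) (s : ℕ) (g : Equiv.Perm (Fin n) → ℝ)
    (x : Equiv.Perm (Fin n)) : expect s g (x * τ) = expect s (fun y => g (y * τ)) x := by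
  induction s generalizing x with
  | zero => simp only [expect_zero]
  | succ s ih =>
    simp only [expect_succ', shuffle_relabel, ih]
    congr 1
    rw [← Equiv.sum_comp τ (fun a => ∑ b, expect s (fun y => g (y * τ)) (shuffle a b x))]
    refine Finset.sum_congr rfl fun a _ => ?_
    exact Equiv.sum_comp τ (fun b => expect s (fun y => g (y * τ)) (shuffle (τ a) b x))

/-! ### Drift of the potential -/

/-- The potential that controls how long `A` keeps meeting `{i, j}` when it is replaced by its
ancestors. -/
noncomputable def potential {n : ℕ} (i j : Fin n) (A : Finset (Fin n)) : ℝ :=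
  if i ∈ A ∧ j ∈ A then 1.65 + (#A : ℝ) / n
  else if i ∈ A ∨ j ∈ A then 1 + (#A : ℝ) / n else 0

lemma potential_comm {n : ℕ} (i j : Fin n) (A : Finset (Fin n)) :
    potential i j A = potential j i A := by
  simp [potential, and_comm, or_comm]

lemma potential_nonneg {n : ℕ} (i j : Fin n) (A : Finset (Fin n)) : 0 ≤ potential i j A := by
  unfold potential
  split_ifs <;> positivity

lemma one_le_potential {n : ℕ} {i j : Fin n} {A : Finset (Fin n)} (h : i ∈ A ∨ j ∈ A) :
    1 ≤ potential i j A := by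
  have : (0 : ℝ) ≤ (#A : ℝ) / n := by positivity
  unfold potential
  split_ifs <;> linarith

lemma card_ancestors_le {n : ℕ} (a b : Fin n) (A : Finset (Fin n)) : #(ancestors a b A) ≤ #A := by
  unfold ancestors
  split_ifs with ha hab
  · exact card_le_card (erase_subset _ _)
  · exact (card_insert_le _ _).trans (by rw [card_erase_add_one ha])
  · exact le_rfl

lemma card_ancestors_add_one {n : ℕ} {a b : Fin n} {A : Finset (Fin n)} (ha : a ∈ A) (hb : b ∈ A) :
    #(ancestors a b A) + 1 = #A := by
  unfold ancestors
  split_ifs with hab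
  · exact card_erase_add_one ha
  · rw [insert_eq_of_mem (mem_erase.2 ⟨Ne.symm hab, hb⟩), card_erase_add_one ha]

lemma card_ancestors_div_le {n : ℕ} {a b : Fin n} {A : Finset (Fin n)} (ha : a ∈ A) :
    (#(ancestors a b A) : ℝ) / n ≤ (#A : ℝ) / n - if b ∈ A then 1 / (n : ℝ) else 0 := by
  split_ifs with hb
  · rw [← card_ancestors_add_one ha hb]
    push_cast
    apply le_of_eq
    ring
  · have : (#(ancestors a b A) : ℝ) ≤ #A := by exact_mod_cast card_ancestors_le a b A
    simp only [sub_zero]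
    gcongr

lemma sum_ite_mem_const {n : ℕ} (A : Finset (Fin n)) (r : ℝ) :
    (∑ b, if b ∈ A then r else 0) = #A * r := by
  simp

lemma sum_potential_of_both {n : ℕ} (hn : 100 ≤ n) {i j : Fin n} (hij : i ≠ j)
    {A : Finset (Fin n)} (hi : i ∈ A) (hj : j ∈ A) :
    ∑ a, ∑ b, potential i j (ancestors a b A) ≤ ((n : ℝ) ^ 2 - 0.7 * n) * potential i j A := by
  have hn' : (100 : ℝ) ≤ n := by exact_mod_cast hn
  have hA : potential i j A = 1.65 + (#A : ℝ) / n := by simp [potential, hi, hj]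
  set ρ : ℝ := (#A : ℝ) / n with hρ
  have hM : (#A : ℝ) = n * ρ := by rw [hρ]; field_simp
  have h0 : 0 ≤ ρ := by rw [hρ]; exact div_nonneg (Nat.cast_nonneg _) (Nat.cast_nonneg _)
  have row : ∀ a, ∑ b, potential i j (ancestors a b A) ≤
      n * (1.65 + ρ) - (if a ∈ A then ρ else 0)
        + ((if a = i then ρ - 0.65 * n else 0) + (if a = j then ρ - 0.65 * n else 0)) := by
    intro a
    by_cases ha : a ∈ A
    · by_cases haij : a = i ∨ a = j
      · have hb : ∀ b, potential i j (ancestors a b A) ≤ 1 + ρ := by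
          intro b
          have hc : (#(ancestors a b A) : ℝ) / n ≤ ρ := by
            rw [hρ]
            gcongr ?_ / _
            exact_mod_cast card_ancestors_le a b A
          have hnot : ¬ (i ∈ ancestors a b A ∧ j ∈ ancestors a b A) := by
            rw [mem_ancestors ha, mem_ancestors ha]
            rcases haij with rfl | rfl <;> grind
          unfold potential
          rw [if_neg hnot]
          split_ifs <;> linarith
        have hs := Finset.sum_le_sum fun b (_ : b ∈ Finset.univ) => hb b
        simp only [sum_const, card_univ, Fintype.card_fin, nsmul_eq_mul] at hs
        rcases haij with rfl | rfl
        · simp only [ha, hij, if_true, if_false]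
          linarith
        · simp only [ha, Ne.symm hij, if_true, if_false]
          linarith
      · push Not at haij
        have hb : ∀ b, potential i j (ancestors a b A) ≤
            1.65 + ρ - if b ∈ A then 1 / (n : ℝ) else 0 := by
          intro b
          have h1 : i ∈ ancestors a b A := by
            unfold ancestors; split_ifs <;> simp [hi, haij.1.symm]
          have h2 : j ∈ ancestors a b A := by
            unfold ancestors; split_ifs <;> simp [hj, haij.2.symm]
          have := card_ancestors_div_le (b := b) ha
          simp only [potential, h1, h2, and_self, if_true]
          linarith
        have hs := Finset.sum_le_sum fun b (_ : b ∈ Finset.univ) => hb b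
        rw [Finset.sum_sub_distrib, sum_ite_mem_const, mul_one_div, ← hρ] at hs
        simp only [sum_const, card_univ, Fintype.card_fin, nsmul_eq_mul] at hs
        simp only [ha, haij.1, haij.2, if_true, if_false]
        linarith
    · have h1 : a ≠ i := fun h => ha (h ▸ hi)
      have h2 : a ≠ j := fun h => ha (h ▸ hj)
      simp [ancestors, ha, hA, h1, h2, mul_add]
  have hs := Finset.sum_le_sum fun a (_ : a ∈ Finset.univ) => row a
  rw [Finset.sum_add_distrib, Finset.sum_add_distrib, Finset.sum_sub_distrib, sum_ite_mem_const]
    at hs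
  simp only [sum_const, card_univ, Fintype.card_fin, nsmul_eq_mul, sum_ite_eq', mem_univ,
    if_true, hM] at hs
  refine hs.trans ?_
  rw [hA]
  have h1 : ρ ≤ 1 := by
    have : #A ≤ n := by simpa using card_le_univ A
    rw [hρ]
    exact div_le_one_of_le₀ (by exact_mod_cast this) (by positivity)
  -- The slack is `n * ((ρ - 0.35) ^ 2 + 0.0225) - 2 * ρ`, nonnegative since `n ≥ 100` and `ρ ≤ 1`.
  nlinarith [mul_nonneg (by linarith : (0 : ℝ) ≤ n) (sq_nonneg (ρ - 0.35))]

lemma sum_potential_of_left {n : ℕ} (hn : 100 ≤ n) {i j : Fin n} (hij : i ≠ j)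
    {A : Finset (Fin n)} (hi : i ∈ A) (hj : j ∉ A) :
    ∑ a, ∑ b, potential i j (ancestors a b A) ≤ ((n : ℝ) ^ 2 - 0.7 * n) * potential i j A := by
  have hn' : (100 : ℝ) ≤ n := by exact_mod_cast hn
  have hA : potential i j A = 1 + (#A : ℝ) / n := by simp [potential, hi, hj]
  set ρ : ℝ := (#A : ℝ) / n with hρ
  have hM : (#A : ℝ) = n * ρ := by rw [hρ]; field_simp
  have h0 : 0 ≤ ρ := by rw [hρ]; exact div_nonneg (Nat.cast_nonneg _) (Nat.cast_nonneg _)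
  have row : ∀ a, ∑ b, potential i j (ancestors a b A) ≤
      n * (1 + ρ) + (if a ∈ A then 0.65 - ρ else 0)
        + (if a = i then 1 + ρ - n * (1 + ρ) - (0.65 - ρ) else 0) := by
    intro a
    by_cases ha : a ∈ A
    · have haj : a ≠ j := fun h => hj (h ▸ ha)
      by_cases hai : a = i
      · subst hai
        -- Moving `i` removes it from the set, so only `b = j` keeps contact with the pair.
        have hb : ∀ b, potential a j (ancestors a b A) ≤ if b = j then 1 + ρ else 0 := by
          intro b
          have hna : a ∉ ancestors a b A := by
            rw [mem_ancestors ha]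
            grind
          by_cases hbj : b = j
          · have hc : (#(ancestors a b A) : ℝ) / n ≤ ρ := by
              rw [hρ]
              gcongr ?_ / _
              exact_mod_cast card_ancestors_le a b A
            rw [if_pos hbj]
            simp only [potential, hna, false_and, false_or, if_false]
            split_ifs <;> linarith
          · have hnj : j ∉ ancestors a b A := by
              rw [mem_ancestors ha]
              grind
            simp [potential, hna, hnj, hbj]
        have hs := Finset.sum_le_sum fun b (_ : b ∈ Finset.univ) => hb b
        simp only [sum_ite_eq', mem_univ, if_true] at hs
        simp only [ha, if_true]
        linarith
      -- The 0.65 is the cost of `j` entering as the target of another card of `A`.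
      · have hb : ∀ b, potential i j (ancestors a b A) ≤
            1 + ρ - (if b ∈ A then 1 / (n : ℝ) else 0) + if b = j then 0.65 else 0 := by
          intro b
          have hc := card_ancestors_div_le (b := b) ha
          have h1 : i ∈ ancestors a b A := by
            unfold ancestors; split_ifs <;> simp [hi, Ne.symm hai]
          have h2 : j ∈ ancestors a b A → b = j := by
            intro h
            by_contra hbj
            unfold ancestors at h
            split_ifs at h <;> simp [hj, Ne.symm hbj] at h
          by_cases hbj : b = j
          · simp only [potential, h1, true_and, true_or, if_true, if_pos hbj]
            split_ifs at * <;> linarith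
          · simp only [potential, h1, mt h2 hbj, and_false, true_or, if_true, if_false, if_neg hbj]
            linarith
        have hs := Finset.sum_le_sum fun b (_ : b ∈ Finset.univ) => hb b
        rw [Finset.sum_add_distrib, Finset.sum_sub_distrib, sum_ite_mem_const, mul_one_div,
          ← hρ] at hs
        simp only [sum_const, card_univ, Fintype.card_fin, nsmul_eq_mul, sum_ite_eq', mem_univ,
          if_true] at hs
        simp only [ha, hai, if_true, if_false]
        linarith
    · have h1 : a ≠ i := fun h => ha (h ▸ hi)
      simp [ancestors, ha, hA, h1, mul_add]
  have hs := Finset.sum_le_sum fun a (_ : a ∈ Finset.univ) => row a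
  rw [Finset.sum_add_distrib, Finset.sum_add_distrib, sum_ite_mem_const] at hs
  simp only [sum_const, card_univ, Fintype.card_fin, nsmul_eq_mul, sum_ite_eq', mem_univ,
    if_true, hM] at hs
  refine hs.trans ?_
  rw [hA]
  have h1 : ρ ≤ 1 := by
    have : #A ≤ n := by simpa using card_le_univ A
    rw [hρ]
    exact div_le_one_of_le₀ (by exact_mod_cast this) (by positivity)
  -- The slack is `n * ((ρ - 0.175) ^ 2 + 0.269375) - (0.35 + 2 * ρ)`.
  nlinarith [mul_nonneg (by linarith : (0 : ℝ) ≤ n) (sq_nonneg (ρ - 0.175))]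

lemma sum_potential_le {n : ℕ} (hn : 100 ≤ n) {i j : Fin n} (hij : i ≠ j) {A : Finset (Fin n)}
    (h : i ∈ A ∨ j ∈ A) :
    ∑ a, ∑ b, potential i j (ancestors a b A) ≤ ((n : ℝ) ^ 2 - 0.7 * n) * potential i j A := by
  by_cases hi : i ∈ A
  · by_cases hj : j ∈ A
    · exact sum_potential_of_both hn hij hi hj
    · exact sum_potential_of_left hn hij hi hj
  · simp only [potential_comm i j]
    exact sum_potential_of_left hn hij.symm (h.resolve_left hi) hi

/-! ### Contraction and the total variation bound -/

theorem abs_expect_sub_le {n : ℕ} (hn : 100 ≤ n) {i j : Fin n} (hij : i ≠ j) (s : ℕ)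
    (A : Finset (Fin n)) (g : Equiv.Perm (Fin n) → ℝ) (hg : OrderDetermined A g)
    (hg1 : ∀ y, |g y| ≤ 1) (x : Equiv.Perm (Fin n)) :
    |expect s g x - expect s g (x * Equiv.swap i j)| ≤
      2 * (1 - 0.7 / (n : ℝ)) ^ s * potential i j A := by
  have hn' : (100 : ℝ) ≤ n := by exact_mod_cast hn
  have hr : 0 ≤ 1 - 0.7 / (n : ℝ) := by
    rw [sub_nonneg]
    exact div_le_one_of_le₀ (by linarith) (by linarith)
  by_cases hA : i ∈ A ∨ j ∈ A
  · induction s generalizing A g with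
    | zero =>
      simp only [expect_zero, pow_zero, mul_one]
      have h1 := abs_sub (g x) (g (x * Equiv.swap i j))
      linarith [hg1 x, hg1 (x * Equiv.swap i j), one_le_potential hA]
    | succ s ih =>
      have step : ∀ a b, |expect s (fun y => g (shuffle a b y)) x -
          expect s (fun y => g (shuffle a b y)) (x * Equiv.swap i j)| ≤
          2 * (1 - 0.7 / (n : ℝ)) ^ s * potential i j (ancestors a b A) := by
        intro a b
        by_cases hB : i ∈ ancestors a b A ∨ j ∈ ancestors a b A
        · exact ih _ _ (hg.comp_shuffle a b) (fun y => hg1 _) hB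
        · push Not at hB
          have := hg.comp_shuffle a b
          rw [expect_relabel,
            ← funext fun y => this _ _ (SameOrder.relabel_swap hB.1 hB.2 y), sub_self, abs_zero]
          exact mul_nonneg (by positivity) (potential_nonneg _ _ _)
      rw [expect_succ, expect_succ, ← sub_div, ← Finset.sum_sub_distrib]
      simp only [← Finset.sum_sub_distrib]
      rw [abs_div, abs_of_nonneg (by positivity : (0 : ℝ) ≤ (n : ℝ) ^ 2),
        div_le_iff₀ (by positivity)]
      calc _ ≤ ∑ a, ∑ b, 2 * (1 - 0.7 / (n : ℝ)) ^ s * potential i j (ancestors a b A) :=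
            (abs_sum_le_sum_abs _ _).trans <| Finset.sum_le_sum fun a _ =>
              (abs_sum_le_sum_abs _ _).trans <| Finset.sum_le_sum fun b _ => step a b
        _ = 2 * (1 - 0.7 / (n : ℝ)) ^ s * ∑ a, ∑ b, potential i j (ancestors a b A) := by
            simp only [Finset.mul_sum]
        _ ≤ 2 * (1 - 0.7 / (n : ℝ)) ^ s * (((n : ℝ) ^ 2 - 0.7 * n) * potential i j A) := by
            gcongr
            exact sum_potential_le hn hij hA
        _ = _ := by
            have hsq : (n : ℝ) ^ 2 - 0.7 * n = (1 - 0.7 / (n : ℝ)) * (n : ℝ) ^ 2 := by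
              field_simp
            rw [hsq, pow_succ]
            ring
  · push Not at hA
    rw [expect_relabel, ← funext fun y => hg _ _ (SameOrder.relabel_swap hA.1 hA.2 y), sub_self,
      abs_zero]
    exact mul_nonneg (by positivity) (potential_nonneg _ _ _)

/-- The sign of the difference of the two laws is an optimal test function. -/
lemma tvDist_eq_expect {n : ℕ} (t : ℕ) (x x' : Equiv.Perm (Fin n)) :
    ∃ g : Equiv.Perm (Fin n) → ℝ, (∀ y, |g y| ≤ 1) ∧
      tvDist ((transition n ^ t) x) ((transition n ^ t) x') =
        1 / 2 * (expect t g x - expect t g x') := by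
  refine ⟨fun y => SignType.sign ((transition n ^ t) x y - (transition n ^ t) x' y), ?_, ?_⟩
  · intro y
    rcases (SignType.sign ((transition n ^ t) x y - (transition n ^ t) x' y)).trichotomy with
      h | h | h <;> simp [h]
  · simp only [tvDist, expect, Matrix.mulVec, dotProduct, ← Finset.sum_sub_distrib, ← sub_mul,
      self_mul_sign]

theorem tvDist_swap_le {n : ℕ} (hn : 100 ≤ n) {i j : Fin n} (hij : i ≠ j) (t : ℕ)
    (x : Equiv.Perm (Fin n)) :
    tvDist ((transition n ^ t) x) ((transition n ^ t) (x * Equiv.swap i j)) ≤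
      2.65 * (1 - 0.7 / (n : ℝ)) ^ t := by
  obtain ⟨g, hg1, hg⟩ := tvDist_eq_expect t x (x * Equiv.swap i j)
  have h := abs_expect_sub_le hn hij t univ g (orderDetermined_univ g) hg1 x
  have hn0 : (n : ℝ) ≠ 0 := by
    have : n ≠ 0 := by omega
    exact_mod_cast this
  have hp : potential i j univ = 2.65 := by
    simp [potential, hn0]
    norm_num
  rw [hg]
  rw [hp] at h
  linarith [le_abs_self (expect t g x - expect t g (x * Equiv.swap i j))]

end RandomToRandom

theorem lemma2 :
    ∃ N : ℕ, ∀ n : ℕ, N ≤ n →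
      ∀ x x' : Equiv.Perm (Fin n), RandomToRandom.Adjacent x x' →
        ∀ t : ℕ, (n : ℝ) * Real.log (n : ℝ) < (t : ℝ) →
          RandomToRandom.tvDist ((RandomToRandom.transition n ^ t) x)
              ((RandomToRandom.transition n ^ t) x') ≤
            Real.exp (-(0.6526 : ℝ) * (t : ℝ) / (n : ℝ)) := by
  refine ⟨max 100 ⌈Real.exp 100⌉₊, fun n hN x x' hx t ht => ?_⟩
  have hn : 100 ≤ n := (le_max_left _ _).trans hN
  have hn' : (100 : ℝ) ≤ n := by exact_mod_cast hn
  have hlog : 100 ≤ Real.log n := by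
    rw [Real.le_log_iff_exp_le (by linarith)]
    exact (Nat.le_ceil _).trans (by exact_mod_cast (le_max_right _ _).trans hN)
  obtain ⟨i, j, hij, rfl⟩ := hx
  -- Swapping the contents of two positions is swapping the two cards there.
  have hsw : Equiv.swap i j * x = x * Equiv.swap (x⁻¹ i) (x⁻¹ j) := by
    rw [Equiv.mul_swap_eq_swap_mul]
    simp
  rw [hsw]
  refine (RandomToRandom.tvDist_swap_le hn (x⁻¹.injective.ne hij) t x).trans ?_
  set u : ℝ := (t : ℝ) / n with hu
  have hu100 : 100 < u := by
    rw [hu, lt_div_iff₀ (by linarith)]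
    nlinarith
  have hr : 0 ≤ 1 - 0.7 / (n : ℝ) := by
    rw [sub_nonneg]
    exact div_le_one_of_le₀ (by linarith) (by linarith)
  have h1 : (1 - 0.7 / (n : ℝ)) ^ t ≤ Real.exp (-0.7 * u) := by
    calc (1 - 0.7 / (n : ℝ)) ^ t ≤ Real.exp (-(0.7 / (n : ℝ))) ^ t := by
          gcongr
          exact Real.one_sub_le_exp_neg _
      _ = Real.exp (-0.7 * u) := by
          rw [← Real.exp_nat_mul, hu]
          congr 1
          ring
  -- Here `0.0474 = 0.7 - 0.6526`, and `u > 100` is ample.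
  have h2 : (2.65 : ℝ) ≤ Real.exp (0.0474 * u) := by
    linarith [Real.add_one_le_exp (0.0474 * u)]
  calc 2.65 * (1 - 0.7 / (n : ℝ)) ^ t ≤ Real.exp (0.0474 * u) * Real.exp (-0.7 * u) := by
        gcongr
    _ = Real.exp (-(0.6526 : ℝ) * (t : ℝ) / (n : ℝ)) := by
        rw [← Real.exp_add, hu]
        congr 1
        ring
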